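/- For $a\in\mathbb C$ and $|q|<1$ put $(a;q)_\infty=\prod_{n=0}^\infty(1-aq^n)$ and $$\Pi_q=q^{1/4}\,\frac{(q^2;q^2)_\infty^2}{(q;q^2)_\infty^2}.$$ Then Gosper's identity $$\sqrt{\Pi_q\Pi_{q^9}}\,\bigl(\Pi_q+3\Pi_{q^9}\bigr)=\Pi_{q^3}^2+3\,\Pi_q\Pi_{q^9}$$ holds for $|q|<1$, in the following sense. (a) For real $0\le q<1$ it holds with the nonnegative real fourth and square roots. (b) For complex $q$ with $0<|q|<1$, write $q=e^{\pi i\tau}$ with $\operatorname{Im}\tau>0$, and let fractional powers be taken with respect to $\tau$: in $\Pi_{q^n}$, the factor $(q^n)^{1/4}$ means $e^{\pi i n\tau/4}$ $(n=1,3,9)$. There is a holomorphic function $S$ on the upper half-plane with $S(\tau)^2=\Pi_q\Pi_{q^9}$ for all $\tau$, equal to the real square root $\sqrt{\Pi_q\Pi_{q^9}}$ from (a) when $\tau=it$, $t>0$ (so that $q=e^{-\pi t}\in(0,1)$). For every such $S$ and every $\tau$ with $\operatorname{Im}\tau>0$, the identity holds with $\sqrt{\Pi_q\Pi_{q^9}}=S(\tau)$.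 -/

import Mathlib

/-- The infinite `q`-shifted factorial `(a; q)_∞ = ∏_{n ≥ 0} (1 - a q ^ n)`. -/
noncomputable def qPochInf {R : Type*} [CommRing R] [TopologicalSpace R] (a q : R) : R :=
  ∏' n : ℕ, (1 - a * q ^ n)

/-- `Π_q = q^{1/4} (q²; q²)_∞² / (q; q²)_∞²` for real `0 ≤ q < 1`, with the nonnegative
fourth root. -/
noncomputable def gosperPiReal (q : ℝ) : ℝ :=
  q ^ ((1 : ℝ) / 4) * (qPochInf (q ^ 2) (q ^ 2) ^ 2 / qPochInf q (q ^ 2) ^ 2)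

/-- The nome `q = exp (π i τ)`. -/
noncomputable def nome (τ : ℂ) : ℂ :=
  Complex.exp (Real.pi * Complex.I * τ)

/-- `Π_q` for `q = exp (π i τ)`, `Im τ > 0`, where `q^{1/4}` means `exp (π i τ / 4)`.
Then `q ^ n` is the nome of `n τ`, and `Π_{q ^ n}` is `gosperPi (n τ)`. -/
noncomputable def gosperPi (τ : ℂ) : ℂ :=
  Complex.exp (Real.pi * Complex.I * τ / 4) *
    (qPochInf (nome τ ^ 2) (nome τ ^ 2) ^ 2 / qPochInf (nome τ) (nome τ ^ 2) ^ 2)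

/-- `S` is the analytic continuation to the upper half-plane of the positive square root of
`Π_q Π_{q^9}`, `0 < q < 1`: it is holomorphic in `τ`, its square is `Π_q Π_{q^9}` for
`q = exp (π i τ)`, and for `τ = i t` with `t > 0`, where `q = exp (-π t)` lies in `(0, 1)`, it is
the real square root. -/
structure IsSqrtGosperPi (S : ℂ → ℂ) : Prop where
  differentiableOn : DifferentiableOn ℂ S {τ : ℂ | 0 < τ.im}
  sq_eq : ∀ τ : ℂ, 0 < τ.im → S τ ^ 2 = gosperPi τ * gosperPi (9 * τ)
  eq_sqrt : ∀ t : ℝ, 0 < t →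
    S (Complex.I * (t : ℂ)) =
      ((√(gosperPiReal (Real.exp (-(Real.pi * t))) *
        gosperPiReal ((Real.exp (-(Real.pi * t))) ^ 9)) : ℝ) : ℂ)

/-! Gauss' product formula turns `Π_q` into `r ψ(q)²`, where `r = q^{1/4}` and `ψ(q) = ∑
q^{n(n+1)/2}`, so the required root is `r⁵ ψ(q) ψ(q⁹)`. The identity is then `r⁶` times a cubic
relation between `ψ(q)`, `ψ(q³)` and `ψ(q⁹)`. That relation comes from computing `ψ(q) ψ(ωq)
ψ(ω²q)`, with `ω` a primitive cube root of unity, in two ways. The series gives `ψ(ωq) = ψ(q) + (ω -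
1) q ψ(q⁹)`, and the product gives `ψ(q³)⁴ / ψ(q⁹)`. By the identity theorem, the values on the
imaginary axis determine the holomorphic root, so an arbitrary `S` is the explicit one. -/

open Filter Topology

/-! ### Gauss' product formula for triangular numbers -/

section Gauss

variable {𝕜 : Type*} [NormedField 𝕜]

/-- Ramanujan's theta function `ψ(q) = ∑ q ^ (n (n + 1) / 2)`. -/
noncomputable def ramanujanPsi (q : 𝕜) : 𝕜 :=
  ∑' n : ℕ, q ^ (n * (n + 1) / 2)

theorem le_triangular (n : ℕ) : n ≤ n * (n + 1) / 2 := by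
  rw [Nat.le_div_iff_mul_le two_pos]
  nlinarith [Nat.zero_le n, Nat.le_mul_self n]

theorem one_sub_pow_ne_zero {q : 𝕜} (hq : ‖q‖ < 1) {n : ℕ} (hn : n ≠ 0) : 1 - q ^ n ≠ 0 := by
  intro h
  have h1 : ‖q ^ n‖ = 1 := by rw [← sub_eq_zero.mp h, norm_one]
  rw [norm_pow] at h1
  exact (pow_lt_one₀ (norm_nonneg q) hq hn).ne h1

/-- The partial products `∏ (1 - q ^ (2 j)) / (1 - q ^ (2 j - 1))` of `ψ(q)`. -/
noncomputable def psiPartialProd (q : 𝕜) (n : ℕ) : 𝕜 :=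
  ∏ j ∈ Finset.range n, (1 - q ^ (2 * j + 2)) / (1 - q ^ (2 * j + 1))

theorem psiPartialProd_ne_zero {q : 𝕜} (hq : ‖q‖ < 1) (n : ℕ) : psiPartialProd q n ≠ 0 :=
  Finset.prod_ne_zero_iff.mpr fun _ _ ↦
    div_ne_zero (one_sub_pow_ne_zero hq (by omega)) (one_sub_pow_ne_zero hq (by omega))

/-- Shanks' finite form of Gauss' identity for triangular numbers. -/
theorem sum_triangular_eq_sum_psiPartialProd {q : 𝕜} (hq : ‖q‖ < 1) (n : ℕ) :
    ∑ k ∈ Finset.range (2 * n), q ^ (k * (k + 1) / 2) =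
      ∑ s ∈ Finset.range n, psiPartialProd q n / psiPartialProd q s * q ^ (s * (2 * n + 1)) := by
  induction n with
  | zero => simp
  | succ n ih =>
    have hP := psiPartialProd_ne_zero hq
    have h1 : 1 - q ^ (2 * n + 1) ≠ 0 := one_sub_pow_ne_zero hq (by omega)
    have hstep (m : ℕ) : psiPartialProd q (m + 1) =
        psiPartialProd q m * ((1 - q ^ (2 * m + 2)) / (1 - q ^ (2 * m + 1))) :=
      Finset.prod_range_succ _ _
    -- A telescoping certificate: raising `n` by one changes the `s`-th summand by `H (s + 1) - H
    -- s`. The boundary value `H (n + 1)` is the new term `k = 2n + 1`; the summand `s = n` at level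
    -- `n`, absent from the old sum, is the term `k = 2n`.
    set H : ℕ → 𝕜 := fun s ↦ psiPartialProd q n / psiPartialProd q s * q ^ (s * (2 * n + 1)) *
      (1 - q ^ (2 * s)) / (1 - q ^ (2 * n + 1)) with hH
    have key (s : ℕ) :
        psiPartialProd q (n + 1) / psiPartialProd q s * q ^ (s * (2 * (n + 1) + 1)) -
          psiPartialProd q n / psiPartialProd q s * q ^ (s * (2 * n + 1)) = H (s + 1) - H s := by
      have h2 : 1 - q ^ (2 * s + 1) ≠ 0 := one_sub_pow_ne_zero hq (by omega)
      have h3 : 1 - q ^ (2 * s + 2) ≠ 0 := one_sub_pow_ne_zero hq (by omega)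
      have h4 := hP s
      have e1 : q ^ (s * (2 * (n + 1) + 1)) = q ^ (s * (2 * n + 1)) * q ^ (2 * s) := by ring
      have e2 : q ^ ((s + 1) * (2 * n + 1)) = q ^ (s * (2 * n + 1)) * q ^ (2 * n + 1) := by ring
      have e3 : q ^ (2 * (s + 1)) = q ^ (2 * s + 2) := by ring
      simp only [hH, hstep, e1, e2, e3]
      field_simp
      ring
    have hsum := Finset.sum_range_sub H (n + 1)
    rw [← Finset.sum_congr rfl fun s _ ↦ key s, Finset.sum_sub_distrib,
      Finset.sum_range_succ
        (fun s ↦ psiPartialProd q n / psiPartialProd q s * q ^ (s * (2 * n + 1))) n, ← ih] at hsum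
    have hlast : H (n + 1) = q ^ ((n + 1) * (2 * n + 1)) := by
      have h3 : 1 - q ^ (2 * n + 2) ≠ 0 := one_sub_pow_ne_zero hq (by omega)
      have h4 := hP n
      have e3 : q ^ (2 * (n + 1)) = q ^ (2 * n + 2) := by ring
      simp only [hH, hstep, e3]
      field_simp
    have hzero : H 0 = 0 := by simp [hH]
    rw [hlast, hzero, div_self (hP n)] at hsum
    have e1 : 2 * n * (2 * n + 1) / 2 = n * (2 * n + 1) := by
      rw [mul_assoc, Nat.mul_div_cancel_left _ two_pos]
    have e2 : (2 * n + 1) * (2 * n + 1 + 1) / 2 = (n + 1) * (2 * n + 1) := by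
      rw [show (2 * n + 1) * (2 * n + 1 + 1) = 2 * ((n + 1) * (2 * n + 1)) by ring,
        Nat.mul_div_cancel_left _ two_pos]
    rw [show 2 * (n + 1) = 2 * n + 1 + 1 by ring, Finset.sum_range_succ, Finset.sum_range_succ,
      e1, e2, ← show 2 * (n + 1) = 2 * n + 1 + 1 by ring]
    linear_combination -hsum

theorem summable_norm_mul_pow {a q : 𝕜} (hq : ‖q‖ < 1) :
    Summable fun n : ℕ ↦ ‖-(a * q ^ n)‖ := by
  simpa using (summable_geometric_of_lt_one (norm_nonneg q) hq).mul_left ‖a‖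

theorem norm_sq_lt_one {q : 𝕜} (hq : ‖q‖ < 1) : ‖q ^ 2‖ < 1 := by
  rw [norm_pow]
  exact pow_lt_one₀ (norm_nonneg q) hq two_ne_zero

variable [CompleteSpace 𝕜]

theorem summable_triangular {q : 𝕜} (hq : ‖q‖ < 1) :
    Summable fun n : ℕ ↦ q ^ (n * (n + 1) / 2) := by
  refine .of_norm_bounded (summable_geometric_of_lt_one (norm_nonneg q) hq) fun n ↦ ?_
  rw [norm_pow]
  exact pow_le_pow_of_le_one (norm_nonneg q) hq.le (le_triangular n)

theorem hasProd_qPochInf {a q : 𝕜} (hq : ‖q‖ < 1) :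
    HasProd (fun n : ℕ ↦ 1 - a * q ^ n) (qPochInf a q) := by
  unfold qPochInf
  simpa [← sub_eq_add_neg] using
    (multipliable_one_add_of_summable (summable_norm_mul_pow (a := a) hq)).hasProd

theorem qPochInf_ne_zero {a q : 𝕜} (hq : ‖q‖ < 1) (h : ∀ n : ℕ, 1 - a * q ^ n ≠ 0) :
    qPochInf a q ≠ 0 := by
  unfold qPochInf
  have := tprod_one_add_ne_zero_of_summable (f := fun n : ℕ ↦ -(a * q ^ n))
    (by simpa [← sub_eq_add_neg] using h) (summable_norm_mul_pow (a := a) hq)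
  simpa [← sub_eq_add_neg] using this

theorem qPochInf_sq_sq_ne_zero {q : 𝕜} (hq : ‖q‖ < 1) : qPochInf (q ^ 2) (q ^ 2) ≠ 0 := by
  refine qPochInf_ne_zero (norm_sq_lt_one hq) fun n ↦ ?_
  rw [← pow_succ', ← pow_mul]
  exact one_sub_pow_ne_zero hq (by omega)

theorem qPochInf_self_sq_ne_zero {q : 𝕜} (hq : ‖q‖ < 1) : qPochInf q (q ^ 2) ≠ 0 := by
  refine qPochInf_ne_zero (norm_sq_lt_one hq) fun n ↦ ?_
  rw [← pow_mul, ← pow_succ']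
  exact one_sub_pow_ne_zero hq (by omega)

theorem tendsto_psiPartialProd {q : 𝕜} (hq : ‖q‖ < 1) :
    Tendsto (psiPartialProd q) atTop
      (𝓝 (qPochInf (q ^ 2) (q ^ 2) / qPochInf q (q ^ 2))) := by
  have h := (hasProd_qPochInf (a := q ^ 2) (norm_sq_lt_one hq)).tendsto_prod_nat.div
    (hasProd_qPochInf (a := q) (norm_sq_lt_one hq)).tendsto_prod_nat (qPochInf_self_sq_ne_zero hq)
  refine h.congr fun n ↦ ?_
  rw [Pi.div_apply, ← Finset.prod_div_distrib]
  refine Finset.prod_congr rfl fun j _ ↦ ?_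
  ring

/-- Gauss' product formula for `ψ(q)`. -/
theorem qPochInf_div_qPochInf_eq_ramanujanPsi {q : 𝕜} (hq : ‖q‖ < 1) :
    qPochInf (q ^ 2) (q ^ 2) / qPochInf q (q ^ 2) = ramanujanPsi q := by
  have hP := tendsto_psiPartialProd hq
  have hL : qPochInf (q ^ 2) (q ^ 2) / qPochInf q (q ^ 2) ≠ 0 :=
    div_ne_zero (qPochInf_sq_sq_ne_zero hq) (qPochInf_self_sq_ne_zero hq)
  obtain ⟨C, hC⟩ := (hP.norm).bddAbove_range
  obtain ⟨D, hD⟩ := ((hP.inv₀ hL).norm).bddAbove_range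
  have hC' (n : ℕ) : ‖psiPartialProd q n‖ ≤ C := hC ⟨n, rfl⟩
  have hD' (n : ℕ) : ‖(psiPartialProd q n)⁻¹‖ ≤ D := hD ⟨n, rfl⟩
  have hC0 : 0 ≤ C := (norm_nonneg _).trans (hC' 0)
  have hsum : Tendsto (fun n ↦ ∑ k ∈ Finset.range (2 * n), q ^ (k * (k + 1) / 2)) atTop
      (𝓝 (ramanujanPsi q)) :=
    (summable_triangular hq).hasSum.tendsto_sum_nat.comp
      (tendsto_id.const_mul_atTop' two_pos)
  have hgeom := summable_geometric_of_lt_one (norm_nonneg q) hq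
  -- In the finite identity the summand `s = 0` is the partial product itself. The partial products
  -- and their inverses are bounded, since the limit is nonzero, so the other summands add up to
  -- `O(‖q‖ ^ n)`.
  have hbound (n : ℕ) : ‖∑ k ∈ Finset.range (2 * (n + 1)), q ^ (k * (k + 1) / 2) -
      psiPartialProd q (n + 1)‖ ≤ C * D * (1 - ‖q‖)⁻¹ * ‖q‖ ^ n := by
    rw [sum_triangular_eq_sum_psiPartialProd hq, Finset.sum_range_succ']
    have h0 : psiPartialProd q 0 = 1 := by simp [psiPartialProd]
    rw [h0]
    simp only [zero_mul, pow_zero, mul_one, div_one, add_sub_cancel_right]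
    refine (norm_sum_le _ _).trans ?_
    have hterm (s : ℕ) : ‖psiPartialProd q (n + 1) / psiPartialProd q (s + 1) *
        q ^ ((s + 1) * (2 * (n + 1) + 1))‖ ≤ C * D * ‖q‖ ^ n * ‖q‖ ^ s := by
      rw [div_eq_mul_inv, norm_mul, norm_mul, norm_pow, mul_assoc (C * D), ← pow_add]
      refine mul_le_mul (mul_le_mul (hC' _) (hD' _) (norm_nonneg _) hC0)
        (pow_le_pow_of_le_one (norm_nonneg q) hq.le ?_) (by positivity)
        (mul_nonneg hC0 ((norm_nonneg _).trans (hD' 0)))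
      nlinarith [Nat.zero_le (s * n)]
    refine (Finset.sum_le_sum fun s _ ↦ hterm s).trans ?_
    rw [← Finset.mul_sum]
    calc C * D * ‖q‖ ^ n * ∑ s ∈ Finset.range n, ‖q‖ ^ s
        ≤ C * D * ‖q‖ ^ n * ∑' s, ‖q‖ ^ s :=
          mul_le_mul_of_nonneg_left (hgeom.sum_le_tsum _ fun _ _ ↦ by positivity)
            (mul_nonneg (mul_nonneg hC0 ((norm_nonneg _).trans (hD' 0))) (by positivity))
      _ = C * D * (1 - ‖q‖)⁻¹ * ‖q‖ ^ n := by
          rw [tsum_geometric_of_lt_one (norm_nonneg q) hq]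
          ring
  have hdiff : Tendsto (fun n ↦ ∑ k ∈ Finset.range (2 * (n + 1)), q ^ (k * (k + 1) / 2) -
      psiPartialProd q (n + 1)) atTop (𝓝 0) := by
    refine squeeze_zero_norm hbound ?_
    simpa using (tendsto_pow_atTop_nhds_zero_of_lt_one (norm_nonneg q) hq).const_mul
      (C * D * (1 - ‖q‖)⁻¹)
  have := tendsto_nhds_unique hdiff
    ((hsum.comp (tendsto_add_atTop_nat 1)).sub (hP.comp (tendsto_add_atTop_nat 1)))
  exact (sub_eq_zero.mp this.symm).symm

/-! ### Trisection of the series -/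

theorem triangular_three_mul_add_one (m : ℕ) :
    (3 * m + 1) * (3 * m + 1 + 1) / 2 = 9 * (m * (m + 1) / 2) + 1 := by
  obtain ⟨k, hk⟩ : 2 ∣ m * (m + 1) := (Nat.even_mul_succ_self m).two_dvd
  have h : (3 * m + 1) * (3 * m + 1 + 1) = 2 * (9 * k + 1) := by linear_combination 9 * hk
  rw [hk, h, Nat.mul_div_cancel_left _ two_pos, Nat.mul_div_cancel_left _ two_pos]

theorem three_dvd_triangular {n : ℕ} (hn : n % 3 ≠ 1) : 3 ∣ n * (n + 1) / 2 := by
  have hd : 3 ∣ n * (n + 1) := by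
    rcases (by omega : n % 3 = 0 ∨ n % 3 = 2) with h | h
    · exact (Nat.dvd_of_mod_eq_zero h).mul_right _
    · exact Dvd.dvd.mul_left (by omega) _
  have h2 : 2 ∣ n * (n + 1) := (Nat.even_mul_succ_self n).two_dvd
  generalize n * (n + 1) = t at *
  omega

/-- Exponents divisible by 3 do not see `ζ`, so only the indices `n = 3m + 1` survive in the
difference; their triangular numbers are `9 T_m + 1`. -/
theorem ramanujanPsi_mul_sub {q ζ : 𝕜} (hq : ‖q‖ < 1) (hζ : ζ ^ 3 = 1) :
    ramanujanPsi (ζ * q) - ramanujanPsi q = (ζ - 1) * q * ramanujanPsi (q ^ 9) := by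
  have hζn : ‖ζ‖ = 1 := by
    have : ‖ζ‖ ^ 3 = 1 := by rw [← norm_pow, hζ, norm_one]
    exact (pow_eq_one_iff_of_nonneg (norm_nonneg ζ) (by norm_num)).mp this
  have hζq : ‖ζ * q‖ < 1 := by rwa [norm_mul, hζn, one_mul]
  have hinj : Function.Injective fun m : ℕ ↦ 3 * m + 1 := fun a b h ↦ by simpa using h
  let f : ℕ → 𝕜 := fun n ↦ (ζ * q) ^ (n * (n + 1) / 2) - q ^ (n * (n + 1) / 2)
  have hf : Function.support f ⊆ Set.range fun m : ℕ ↦ 3 * m + 1 := by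
    intro n hn
    by_contra hr
    obtain ⟨k, hk⟩ := three_dvd_triangular (n := n) fun h ↦ hr ⟨n / 3, by dsimp only; omega⟩
    exact hn (by simp only [f, hk, mul_pow, pow_mul ζ, hζ, one_pow, one_mul, sub_self])
  have hterm (m : ℕ) : f (3 * m + 1) = (ζ - 1) * q * (q ^ 9) ^ (m * (m + 1) / 2) := by
    simp only [f, triangular_three_mul_add_one]
    generalize m * (m + 1) / 2 = k
    rw [mul_pow, pow_succ ζ, pow_mul ζ, show ζ ^ 9 = (ζ ^ 3) ^ 3 by ring, hζ, ← pow_mul]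
    simp only [one_pow]
    ring
  calc ramanujanPsi (ζ * q) - ramanujanPsi q = ∑' n, f n :=
        ((summable_triangular hζq).tsum_sub (summable_triangular hq)).symm
    _ = ∑' m : ℕ, f (3 * m + 1) := (hinj.tsum_eq hf).symm
    _ = ∑' m : ℕ, (ζ - 1) * q * (q ^ 9) ^ (m * (m + 1) / 2) := tsum_congr hterm
    _ = _ := tsum_mul_left

end Gauss

/-! ### Products over cube roots of unity and the cubic relation -/

section Cubic

/-- Euler's product `∏_{n ≥ 1} (1 - q ^ n)`. -/
noncomputable def eulerProd (q : ℂ) : ℂ :=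
  ∏' n : ℕ, (1 - q ^ (n + 1))

theorem tendsto_eulerProd {q : ℂ} (hq : ‖q‖ < 1) :
    Tendsto (fun N ↦ ∏ n ∈ Finset.range N, (1 - q ^ (n + 1))) atTop (𝓝 (eulerProd q)) :=
  (ModularForm.multipliable_one_sub_pow hq).hasProd.tendsto_prod_nat

theorem eulerProd_eq_qPochInf (q : ℂ) : eulerProd q = qPochInf q q := by
  simp only [eulerProd, qPochInf, pow_succ']

theorem eulerProd_ne_zero {q : ℂ} (hq : ‖q‖ < 1) : eulerProd q ≠ 0 := by
  rw [eulerProd_eq_qPochInf]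
  refine qPochInf_ne_zero hq fun n ↦ ?_
  rw [← pow_succ']
  exact one_sub_pow_ne_zero hq (by omega)

theorem eulerProd_eq_mul_qPochInf {q : ℂ} (hq : ‖q‖ < 1) :
    eulerProd q = qPochInf q (q ^ 2) * eulerProd (q ^ 2) := by
  have h1 := (tendsto_eulerProd hq).comp (tendsto_id.const_mul_atTop' two_pos)
  have h2 := (hasProd_qPochInf (a := q) (norm_sq_lt_one hq)).tendsto_prod_nat.mul
    (tendsto_eulerProd (norm_sq_lt_one hq))
  refine tendsto_nhds_unique h1 (h2.congr fun N ↦ ?_)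
  simp only [Function.comp_apply, id_eq]
  induction N with
  | zero => simp
  | succ N ih =>
    rw [show 2 * (N + 1) = 2 * N + 1 + 1 by ring]
    simp only [Finset.prod_range_succ]
    rw [← ih]
    ring

theorem ramanujanPsi_mul_eulerProd {q : ℂ} (hq : ‖q‖ < 1) :
    ramanujanPsi q * eulerProd q = eulerProd (q ^ 2) ^ 2 := by
  rw [← qPochInf_div_qPochInf_eq_ramanujanPsi hq, eulerProd_eq_mul_qPochInf hq,
    ← eulerProd_eq_qPochInf]
  have := qPochInf_self_sq_ne_zero hq
  field_simp

theorem norm_pow_lt_one {q : ℂ} (hq : ‖q‖ < 1) {n : ℕ} (hn : n ≠ 0) : ‖q ^ n‖ < 1 := by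
  rw [norm_pow]
  exact pow_lt_one₀ (norm_nonneg q) hq hn

theorem norm_mul_lt_one_of_pow_three {q ζ : ℂ} (hq : ‖q‖ < 1) (hζ : ζ ^ 3 = 1) : ‖ζ * q‖ < 1 := by
  rwa [norm_mul, Complex.norm_eq_one_of_pow_eq_one hζ three_ne_zero, one_mul]

/-- The three factors of index `n` multiply to `1 - q^{3n}` if `3 ∤ n` and to `(1 - q^n)³` if `3 ∣
n`. The former lack the indices `3 ∣ n` of `eulerProd (q ^ 3)`, which `eulerProd (q ^ 9)` restores.
-/
theorem eulerProd_mul_rotations {q ω : ℂ} (hq : ‖q‖ < 1) (hω : ω ^ 2 + ω + 1 = 0) :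
    eulerProd q * eulerProd (ω * q) * eulerProd (ω ^ 2 * q) * eulerProd (q ^ 9) =
      eulerProd (q ^ 3) ^ 4 := by
  have hω3 : ω ^ 3 = 1 := by linear_combination (ω - 1) * hω
  have hω6 : (ω ^ 2) ^ 3 = 1 := by rw [← pow_mul, mul_comm, pow_mul, hω3, one_pow]
  have h3 : Tendsto (fun N : ℕ ↦ 3 * N) atTop atTop := tendsto_id.const_mul_atTop' three_pos
  have hL := ((((tendsto_eulerProd hq).comp h3).mul
    ((tendsto_eulerProd (norm_mul_lt_one_of_pow_three hq hω3)).comp h3)).mul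
    ((tendsto_eulerProd (norm_mul_lt_one_of_pow_three hq hω6)).comp h3)).mul
    (tendsto_eulerProd (norm_pow_lt_one hq (n := 9) (by norm_num)))
  -- One factor is truncated at `3N` and the other three at `N`, which makes the two partial
  -- products equal for every `N`.
  have hR := ((tendsto_eulerProd (norm_pow_lt_one hq (n := 3) (by norm_num))).comp h3).mul
    ((tendsto_eulerProd (norm_pow_lt_one hq (n := 3) (by norm_num))).pow 3)
  rw [show eulerProd (q ^ 3) ^ 4 = eulerProd (q ^ 3) * eulerProd (q ^ 3) ^ 3 by ring]
  refine tendsto_nhds_unique hL (hR.congr fun N ↦ ?_)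
  simp only [Function.comp_apply]
  have hcyc (x : ℂ) : (1 - x) * (1 - ω * x) * (1 - ω ^ 2 * x) = 1 - x ^ 3 := by
    linear_combination (-x + ω * x ^ 2 - (ω - 1) * x ^ 3) * hω
  induction N with
  | zero => simp
  | succ N ih =>
    have a0 : ω ^ (3 * N + 1) = ω := by rw [pow_succ, pow_mul, hω3]; simp
    have a1 : ω ^ (3 * N + 1 + 1) = ω ^ 2 := by rw [pow_succ, a0, sq]
    have a2 : ω ^ (3 * N + 1 + 1 + 1) = 1 := by
      rw [show 3 * N + 1 + 1 + 1 = 3 * (N + 1) by ring, pow_mul, hω3, one_pow]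
    have b1 : (ω ^ 2) ^ (3 * N + 1 + 1) = ω := by
      rw [pow_right_comm, a1]
      linear_combination ω * hω3
    have b2 : (ω ^ 2) ^ (3 * N + 1 + 1 + 1) = 1 := by rw [pow_right_comm, a2, one_pow]
    have b0 : (ω ^ 2) ^ (3 * N + 1) = ω ^ 2 := by rw [pow_right_comm, a0]
    have c0 := hcyc (q ^ (3 * N + 1))
    have c1 := hcyc (q ^ (3 * N + 1 + 1))
    have c2 : (q ^ (3 * N + 1 + 1 + 1)) = (q ^ 3) ^ (N + 1) := by ring
    have c3 : (q ^ 9) ^ (N + 1) = (q ^ 3) ^ (3 * N + 1 + 1 + 1) := by ring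
    have c4 : (q ^ (3 * N + 1)) ^ 3 = (q ^ 3) ^ (3 * N + 1) := by ring
    have c5 : (q ^ (3 * N + 1 + 1)) ^ 3 = (q ^ 3) ^ (3 * N + 1 + 1) := by ring
    rw [c4] at c0
    rw [c5] at c1
    rw [show 3 * (N + 1) = 3 * N + 1 + 1 + 1 by ring]
    simp only [Finset.prod_range_succ]
    rw [mul_pow ω, mul_pow ω, mul_pow ω, mul_pow (ω ^ 2), mul_pow (ω ^ 2), mul_pow (ω ^ 2), a0, a1,
      a2, b0, b1, b2, c3, ← c0, ← c1, ← c2, mul_pow]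
    linear_combination ((1 - q ^ (3 * N + 1)) * (1 - ω * q ^ (3 * N + 1)) *
      (1 - ω ^ 2 * q ^ (3 * N + 1)) * ((1 - q ^ (3 * N + 1 + 1)) * (1 - ω * q ^ (3 * N + 1 + 1)) *
      (1 - ω ^ 2 * q ^ (3 * N + 1 + 1))) * (1 - (q ^ 3) ^ (3 * N + 1 + 1 + 1)) *
      (1 - q ^ (3 * N + 1 + 1 + 1)) ^ 3) * ih

/-- Since `ψ(q) = E(q²)² / E(q)` with `E` Euler's product, this is the square of the Euler product
relation at `q²` divided by that at `q`; squaring merely swaps `ω` and `ω²`. -/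
theorem ramanujanPsi_mul_rotations {q ω : ℂ} (hq : ‖q‖ < 1) (hω : ω ^ 2 + ω + 1 = 0) :
    ramanujanPsi q * ramanujanPsi (ω * q) * ramanujanPsi (ω ^ 2 * q) * ramanujanPsi (q ^ 9) =
      ramanujanPsi (q ^ 3) ^ 4 := by
  have hω3 : ω ^ 3 = 1 := by linear_combination (ω - 1) * hω
  have hω6 : (ω ^ 2) ^ 3 = 1 := by rw [← pow_mul, mul_comm, pow_mul, hω3, one_pow]
  have hq1 := norm_mul_lt_one_of_pow_three hq hω3
  have hq2 := norm_mul_lt_one_of_pow_three hq hω6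
  have hq3 : ‖q ^ 3‖ < 1 := norm_pow_lt_one hq (by norm_num)
  have hq9 : ‖q ^ 9‖ < 1 := norm_pow_lt_one hq (by norm_num)
  have h1 := eulerProd_mul_rotations hq hω
  have h2 := eulerProd_mul_rotations (norm_sq_lt_one hq) hω
  have p0 := ramanujanPsi_mul_eulerProd hq
  have p1 := ramanujanPsi_mul_eulerProd hq1
  have p2 := ramanujanPsi_mul_eulerProd hq2
  have p3 := ramanujanPsi_mul_eulerProd hq3
  have p9 := ramanujanPsi_mul_eulerProd hq9
  rw [mul_pow] at p1
  rw [mul_pow, show (ω ^ 2) ^ 2 = ω by linear_combination ω * hω3] at p2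
  rw [pow_right_comm] at p3 p9
  refine mul_right_cancel₀ (pow_ne_zero 4 (eulerProd_ne_zero hq3)) ?_
  rw [← mul_pow, p3, ← h1]
  calc _ = (ramanujanPsi q * eulerProd q) * (ramanujanPsi (ω * q) * eulerProd (ω * q)) *
        (ramanujanPsi (ω ^ 2 * q) * eulerProd (ω ^ 2 * q)) *
        (ramanujanPsi (q ^ 9) * eulerProd (q ^ 9)) := by ring
    _ = (eulerProd (q ^ 2) * eulerProd (ω * q ^ 2) * eulerProd (ω ^ 2 * q ^ 2) *
        eulerProd ((q ^ 2) ^ 9)) ^ 2 := by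
      rw [p0, p1, p2, p9]
      ring
    _ = _ := by
      rw [h2]
      ring

/-- The cubic theta function identity behind Gosper's `Π_q` identity of level nine. -/
theorem ramanujanPsi_cubic {q : ℂ} (hq : ‖q‖ < 1) :
    ramanujanPsi (q ^ 9) * (ramanujanPsi q ^ 3 - 3 * q * ramanujanPsi q ^ 2 * ramanujanPsi (q ^ 9) +
      3 * q ^ 2 * ramanujanPsi q * ramanujanPsi (q ^ 9) ^ 2) = ramanujanPsi (q ^ 3) ^ 4 := by
  obtain ⟨ω, hω⟩ : ∃ ω : ℂ, ω ^ 2 + ω + 1 = 0 := by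
    have hp := Complex.isPrimitiveRoot_exp 3 three_ne_zero
    have := hp.geom_sum_eq_zero (by norm_num)
    simp only [Finset.sum_range_succ, Finset.sum_range_zero] at this
    exact ⟨_, by linear_combination this⟩
  have hω3 : ω ^ 3 = 1 := by linear_combination (ω - 1) * hω
  have hω6 : (ω ^ 2) ^ 3 = 1 := by rw [← pow_mul, mul_comm, pow_mul, hω3, one_pow]
  rw [← ramanujanPsi_mul_rotations hq hω, sub_eq_iff_eq_add.mp (ramanujanPsi_mul_sub hq hω3),
    sub_eq_iff_eq_add.mp (ramanujanPsi_mul_sub hq hω6)]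
  generalize ramanujanPsi q = u
  generalize ramanujanPsi (q ^ 9) = w
  have hw2 : ω ^ 2 = -1 - ω := by linear_combination hω
  rw [hw2]
  linear_combination (w ^ 3 * u * q ^ 2) * hω

end Cubic

/-! ### Gosper's identity, real and complex -/

section Gosper

theorem ramanujanPsi_ofReal (q : ℝ) : ((ramanujanPsi q : ℝ) : ℂ) = ramanujanPsi (q : ℂ) := by
  simp only [ramanujanPsi, Complex.ofReal_tsum, Complex.ofReal_pow]

theorem ramanujanPsi_nonneg {q : ℝ} (hq : 0 ≤ q) : 0 ≤ ramanujanPsi q :=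
  tsum_nonneg fun _ ↦ by positivity

theorem differentiableOn_ramanujanPsi :
    DifferentiableOn ℂ (ramanujanPsi : ℂ → ℂ) (Metric.ball 0 1) := by
  have hE : DifferentiableOn ℂ eulerProd (Metric.ball 0 1) :=
    ModularForm.differentiableOn_tprod_one_sub_pow
  have hE2 : DifferentiableOn ℂ (fun q ↦ eulerProd (q ^ 2)) (Metric.ball 0 1) :=
    hE.comp (by fun_prop) fun q hq ↦ by
      simpa using norm_sq_lt_one (mem_ball_zero_iff.mp hq)
  refine ((hE2.pow 2).div hE fun q hq ↦ eulerProd_ne_zero (mem_ball_zero_iff.mp hq)).congr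
    fun q hq ↦ ?_
  have hq' := mem_ball_zero_iff.mp hq
  exact eq_div_of_mul_eq (eulerProd_ne_zero hq') (ramanujanPsi_mul_eulerProd hq')

/-- With `r` in the role of `q^{1/4}` all powers are integral, so one polynomial identity serves
both the real and the complex case. -/
theorem gosper_of_pow_four {r : ℂ} (hr : ‖r ^ 4‖ < 1) :
    r ^ 5 * ramanujanPsi (r ^ 4) * ramanujanPsi ((r ^ 4) ^ 9) *
        (r * ramanujanPsi (r ^ 4) ^ 2 + 3 * (r ^ 9 * ramanujanPsi ((r ^ 4) ^ 9) ^ 2)) =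
      (r ^ 3 * ramanujanPsi ((r ^ 4) ^ 3) ^ 2) ^ 2 +
        3 * (r * ramanujanPsi (r ^ 4) ^ 2) * (r ^ 9 * ramanujanPsi ((r ^ 4) ^ 9) ^ 2) := by
  linear_combination r ^ 6 * ramanujanPsi_cubic hr

theorem gosperPiReal_pow {q : ℝ} (hq0 : 0 ≤ q) (hq : q < 1) {n : ℕ} (hn : n ≠ 0) :
    gosperPiReal (q ^ n) = (q ^ ((1 : ℝ) / 4)) ^ n * ramanujanPsi (q ^ n) ^ 2 := by
  have h : ‖q ^ n‖ < 1 := by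
    rw [norm_pow, Real.norm_of_nonneg hq0]
    exact pow_lt_one₀ hq0 hq hn
  rw [gosperPiReal, ← div_pow, qPochInf_div_qPochInf_eq_ramanujanPsi h, Real.rpow_pow_comm hq0]

theorem rpow_quarter_pow_four {q : ℝ} (hq : 0 ≤ q) : (q ^ ((1 : ℝ) / 4)) ^ 4 = q := by
  rw [← Real.rpow_natCast, ← Real.rpow_mul hq]
  norm_num

theorem sqrt_gosperPiReal {q : ℝ} (hq0 : 0 ≤ q) (hq : q < 1) :
    √(gosperPiReal q * gosperPiReal (q ^ 9)) =
      (q ^ ((1 : ℝ) / 4)) ^ 5 * ramanujanPsi q * ramanujanPsi (q ^ 9) := by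
  have h1 := gosperPiReal_pow hq0 hq one_ne_zero
  simp only [pow_one] at h1
  rw [h1, gosperPiReal_pow hq0 hq (by norm_num)]
  have h2 := ramanujanPsi_nonneg hq0
  have h3 := ramanujanPsi_nonneg (pow_nonneg hq0 9)
  rw [← Real.sqrt_sq (by positivity : 0 ≤ (q ^ ((1 : ℝ) / 4)) ^ 5 * ramanujanPsi q *
    ramanujanPsi (q ^ 9))]
  congr 1
  ring

theorem gosper_real {q : ℝ} (hq0 : 0 ≤ q) (hq : q < 1) :
    √(gosperPiReal q * gosperPiReal (q ^ 9)) * (gosperPiReal q + 3 * gosperPiReal (q ^ 9)) =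
      gosperPiReal (q ^ 3) ^ 2 + 3 * gosperPiReal q * gosperPiReal (q ^ 9) := by
  have h1 := gosperPiReal_pow hq0 hq one_ne_zero
  simp only [pow_one] at h1
  have h4 := rpow_quarter_pow_four hq0
  rw [sqrt_gosperPiReal hq0 hq, h1, gosperPiReal_pow hq0 hq (n := 9) (by norm_num),
    gosperPiReal_pow hq0 hq (n := 3) (by norm_num)]
  generalize q ^ ((1 : ℝ) / 4) = r at h4
  subst h4
  -- The cubic relation is available over `ℂ`, where the cube roots of unity live.
  apply Complex.ofReal_injective
  push_cast [ramanujanPsi_ofReal]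
  refine gosper_of_pow_four ?_
  rwa [← Complex.ofReal_pow, Complex.norm_of_nonneg hq0]

theorem norm_nome_lt_one {τ : ℂ} (hτ : 0 < τ.im) : ‖nome τ‖ < 1 := by
  rw [nome, Complex.norm_exp, Real.exp_lt_one_iff]
  have : (Real.pi * Complex.I * τ).re = -(Real.pi * τ.im) := by simp
  rw [this]
  have := mul_pos Real.pi_pos hτ
  linarith

theorem nome_natCast_mul (n : ℕ) (τ : ℂ) : nome (n * τ) = nome τ ^ n := by
  rw [nome, nome, ← Complex.exp_nat_mul]
  ring_nf

theorem exp_quarter_pow_four (τ : ℂ) : Complex.exp (Real.pi * Complex.I * τ / 4) ^ 4 = nome τ := by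
  rw [nome, ← Complex.exp_nat_mul]
  push_cast
  ring_nf

theorem gosperPi_natCast_mul {τ : ℂ} (hτ : 0 < τ.im) {n : ℕ} (hn : n ≠ 0) :
    gosperPi (n * τ) =
      Complex.exp (Real.pi * Complex.I * τ / 4) ^ n * ramanujanPsi (nome τ ^ n) ^ 2 := by
  have h := norm_pow_lt_one (norm_nome_lt_one hτ) hn
  rw [gosperPi, ← div_pow, nome_natCast_mul, qPochInf_div_qPochInf_eq_ramanujanPsi h,
    ← Complex.exp_nat_mul]
  ring_nf

/-- The holomorphic square root `q ^ (5 / 4) ψ(q) ψ(q ^ 9)` of `Π_q Π_{q ^ 9}`. -/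
noncomputable def sqrtGosperPi (τ : ℂ) : ℂ :=
  Complex.exp (Real.pi * Complex.I * τ / 4) ^ 5 * ramanujanPsi (nome τ) * ramanujanPsi (nome τ ^ 9)

theorem isSqrtGosperPi_sqrtGosperPi : IsSqrtGosperPi sqrtGosperPi where
  differentiableOn := by
    have hn : Differentiable ℂ nome := by
      unfold nome
      fun_prop
    have h1 : DifferentiableOn ℂ (fun τ ↦ ramanujanPsi (nome τ)) {τ : ℂ | 0 < τ.im} :=
      differentiableOn_ramanujanPsi.comp hn.differentiableOn fun τ hτ ↦
        mem_ball_zero_iff.mpr (norm_nome_lt_one hτ)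
    have h9 : DifferentiableOn ℂ (fun τ ↦ ramanujanPsi (nome τ ^ 9)) {τ : ℂ | 0 < τ.im} :=
      differentiableOn_ramanujanPsi.comp (hn.pow 9).differentiableOn fun τ hτ ↦
        mem_ball_zero_iff.mpr (norm_pow_lt_one (norm_nome_lt_one hτ) (by norm_num))
    have he : Differentiable ℂ fun τ : ℂ ↦ Complex.exp (Real.pi * Complex.I * τ / 4) ^ 5 := by
      fun_prop
    exact (he.differentiableOn.mul h1).mul h9
  sq_eq τ hτ := by
    have h1 := gosperPi_natCast_mul hτ one_ne_zero
    have h9 := gosperPi_natCast_mul hτ (n := 9) (by norm_num)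
    simp only [pow_one, Nat.cast_one, one_mul] at h1
    push_cast at h9
    rw [h1, h9, sqrtGosperPi]
    ring
  eq_sqrt t ht := by
    have hlt : Real.exp (-(Real.pi * t)) < 1 := by
      rw [Real.exp_lt_one_iff]
      have := mul_pos Real.pi_pos ht
      linarith
    have hI : Real.pi * Complex.I * (Complex.I * t) = ((-(Real.pi * t) : ℝ) : ℂ) := by
      push_cast
      linear_combination Real.pi * t * Complex.I_sq
    have hr : (Real.exp (-(Real.pi * t))) ^ ((1 : ℝ) / 4) = Real.exp (-(Real.pi * t) / 4) := by
      rw [← Real.exp_mul]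
      ring_nf
    rw [sqrt_gosperPiReal (Real.exp_nonneg _) hlt, hr, sqrtGosperPi, nome, hI]
    push_cast [ramanujanPsi_ofReal]
    rfl

/-- Both functions are prescribed on the ray `it`, which accumulates at `i`; the half-plane is
connected, so the identity theorem applies. -/
theorem IsSqrtGosperPi.eqOn {S T : ℂ → ℂ} (hS : IsSqrtGosperPi S) (hT : IsSqrtGosperPi T) :
    Set.EqOn S T {τ : ℂ | 0 < τ.im} := by
  have hopen : IsOpen {τ : ℂ | 0 < τ.im} := isOpen_lt continuous_const Complex.continuous_im
  have hconn : IsPreconnected {τ : ℂ | 0 < τ.im} := (convex_halfSpace_im_gt 0).isPreconnected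
  refine (hS.differentiableOn.analyticOnNhd hopen).eqOn_of_preconnected_of_frequently_eq
    (hT.differentiableOn.analyticOnNhd hopen) hconn (z₀ := Complex.I) (by simp) ?_
  have hray : Tendsto (fun t : ℝ ↦ Complex.I * (t : ℂ)) (𝓝[≠] 1) (𝓝[≠] Complex.I) := by
    refine tendsto_nhdsWithin_of_tendsto_nhds_of_eventually_within _ ?_ ?_
    · have : ContinuousAt (fun t : ℝ ↦ Complex.I * (t : ℂ)) 1 := by fun_prop
      simpa using this.tendsto.mono_left nhdsWithin_le_nhds
    · filter_upwards [self_mem_nhdsWithin] with t ht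
      simpa using ht
  refine hray.frequently (Eventually.frequently ?_)
  filter_upwards [nhdsWithin_le_nhds (lt_mem_nhds one_pos)] with t ht
  rw [hS.eq_sqrt t ht, hT.eq_sqrt t ht]

theorem gosper_complex {τ : ℂ} (hτ : 0 < τ.im) :
    sqrtGosperPi τ * (gosperPi τ + 3 * gosperPi (9 * τ)) =
      gosperPi (3 * τ) ^ 2 + 3 * gosperPi τ * gosperPi (9 * τ) := by
  have h1 := gosperPi_natCast_mul hτ one_ne_zero
  have h3 := gosperPi_natCast_mul hτ (n := 3) (by norm_num)
  have h9 := gosperPi_natCast_mul hτ (n := 9) (by norm_num)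
  simp only [pow_one, Nat.cast_one, one_mul] at h1
  push_cast at h3 h9
  have hlt := norm_nome_lt_one hτ
  rw [h1, h3, h9, sqrtGosperPi]
  rw [← exp_quarter_pow_four] at hlt ⊢
  exact gosper_of_pow_four hlt

end Gosper

theorem mainTheorem12 :
    (∀ q : ℝ, 0 ≤ q → q < 1 →
      √(gosperPiReal q * gosperPiReal (q ^ 9)) * (gosperPiReal q + 3 * gosperPiReal (q ^ 9)) =
        gosperPiReal (q ^ 3) ^ 2 + 3 * gosperPiReal q * gosperPiReal (q ^ 9)) ∧
    (∃ S : ℂ → ℂ, IsSqrtGosperPi S) ∧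
    (∀ S : ℂ → ℂ, IsSqrtGosperPi S → ∀ τ : ℂ, 0 < τ.im →
      S τ * (gosperPi τ + 3 * gosperPi (9 * τ)) =
        gosperPi (3 * τ) ^ 2 + 3 * gosperPi τ * gosperPi (9 * τ)) := by
  exact ⟨fun _ ↦ gosper_real, ⟨_, isSqrtGosperPi_sqrtGosperPi⟩, fun S hS τ hτ ↦ by
    rw [hS.eqOn isSqrtGosperPi_sqrtGosperPi hτ, gosper_complex hτ]⟩
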